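/- Let $G=(V,E)$ be a finite simple undirected graph without isolated vertices and with at least one edge. A matching of $G$ is a set $M\subseteq E$ of edges such that no two distinct edges of $M$ share a common endpoint. The matching polytope of $G$ is $$\mathrm{Mat}(G)\;=\;\operatorname{conv}\{\,1_M : M\subseteq E \text{ is a matching of } G\,\}\subset\mathbb R^E,$$ where $1_M\in\{0,1\}^E$ is the characteristic vector of $M$. A polytope $P$ is called (Minkowski) indecomposable if there are no polytopes $Q,R$ with $P=Q+R=\{q+r: q\in Q,\ r\in R\}$ such that neither $Q$ nor $R$ is homothetic to $P$; here $Q$ is homothetic to $P$ if $Q=cP+t$ for some real $c>0$ and some vector $t$. Then $\mathrm{Mat}(G)$ is indecomposable if and only if $G$ is connected. -/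

import Mathlib

open scoped Pointwise

/-- A (convex) polytope in a real vector space: the convex hull of finitely many points. -/
def IsPolytope {E : Type*} [AddCommGroup E] [Module ℝ E] (P : Set E) : Prop :=
  ∃ S : Set E, S.Finite ∧ P = convexHull ℝ S

/-- `Q` is homothetic to `P`: it arises from `P` by a positive dilation and a translation. -/
def IsHomothetic {E : Type*} [AddCommGroup E] [Module ℝ E] (Q P : Set E) : Prop :=
  ∃ (c : ℝ) (t : E), 0 < c ∧ Q = (fun x => c • x + t) '' P

/-- `P` is Minkowski decomposable: it is the Minkowski sum of two polytopes neither of which is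
homothetic to `P`. -/
def IsMinkowskiDecomposable {E : Type*} [AddCommGroup E] [Module ℝ E] (P : Set E) : Prop :=
  ∃ Q R : Set E, IsPolytope Q ∧ IsPolytope R ∧ P = Q + R ∧
    ¬ IsHomothetic Q P ∧ ¬ IsHomothetic R P

/-- `P` is a (Minkowski) indecomposable polytope. -/
def IsIndecomposablePolytope {E : Type*} [AddCommGroup E] [Module ℝ E] (P : Set E) : Prop :=
  IsPolytope P ∧ ¬ IsMinkowskiDecomposable P

/-- A set `M` of edges of `G` is a matching if no two distinct edges in `M` are incident to a
common vertex. (Mathlib's `SimpleGraph.Subgraph.IsMatching` is about subgraphs; here a matching is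
a set of edges.) -/
def IsEdgeMatching {V : Type*} (G : SimpleGraph V) (M : Set G.edgeSet) : Prop :=
  ∀ e ∈ M, ∀ f ∈ M, e ≠ f → ¬ ∃ v : V, v ∈ (e : Sym2 V) ∧ v ∈ (f : Sym2 V)

/-- The matching polytope of `G`, in the space `ℝ^E` with one coordinate for each edge of `G`: the
convex hull of the characteristic vectors of all matchings of `G`. -/
def matchingPolytope {V : Type*} (G : SimpleGraph V) : Set (G.edgeSet → ℝ) :=
  convexHull ℝ {x | ∃ M : Set G.edgeSet, IsEdgeMatching G M ∧ x = M.indicator 1}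

/-!
The argument works with linear functionals on a Minkowski sum `P = Q + R`, and needs neither the
face lattice of the matching polytope nor Edmonds' description of its facets.

Write every vertex of `P` as `q + r` with `q ∈ Q`, `r ∈ R`. A functional that is maximal over `P`
at two vertices takes the same value at their `Q`-parts (`apply_eq_of_add_maximal`), and `Q` is the
convex hull of the `Q`-parts of the vertices (`eq_convexHull_range_of_add`). For the matching
polytope, let `q M` be the `Q`-part of `1_M`.

* `-x_e` is maximal over `P` at all `1_M` with `e ∉ M`, and `x_e` at all `1_M` with `e ∈ M`. Hence
  `q M = q ∅ + ∑_{e ∈ M} l e • 1_e` for numbers `l e` that do not depend on `M`.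
* If `e` and `f` are distinct and share an endpoint, then `x_e + x_f ≤ 1` on `P`, with equality at
  `1_{e}` and `1_{f}`, so `l e = l f`. If `G` is connected, then `l` is a constant `c`.

So `Q = c P + q ∅`, and likewise `R = (1 - c) P + r ∅`. One of `c`, `1 - c` is positive, so `Q` or
`R` is homothetic to `P`.

If `G` is not connected, let `A` be the set of edges in one component. Matchings of `G` are the
unions of a matching inside `A` and one inside `Aᶜ`, so `P` is the sum of the corresponding
polytopes. Each of these lies in a coordinate hyperplane `x_e = 0`, and no homothetic copy of `P`
does, because `P` contains `0` and `1_e`.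
-/

/-! ### Linear functionals on Minkowski sums -/

theorem apply_eq_of_add_maximal {E : Type*} [AddCommGroup E] [Module ℝ E] {Q R : Set E}
    (l : E →ₗ[ℝ] ℝ) {c : ℝ} (hl : ∀ x ∈ Q + R, l x ≤ c) {q q' r r' : E}
    (hq : q ∈ Q) (hq' : q' ∈ Q) (hr : r ∈ R) (hr' : r' ∈ R)
    (h : l (q + r) = c) (h' : l (q' + r') = c) : l q = l q' := by
  -- Exchange the two `R`-parts: `q + r'` and `q' + r` also lie in the sum.
  have h1 := hl _ (Set.add_mem_add hq hr')
  have h2 := hl _ (Set.add_mem_add hq' hr)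
  rw [map_add] at h h' h1 h2
  linarith

theorem le_of_mem_convexHull {E : Type*} [AddCommGroup E] [Module ℝ E] {S : Set E}
    (l : E →ₗ[ℝ] ℝ) {c : ℝ} (h : ∀ x ∈ S, l x ≤ c) {x : E} (hx : x ∈ convexHull ℝ S) :
    l x ≤ c :=
  convexHull_min (t := {x | l x ≤ c}) h (convex_halfSpace_le l.isLinear c) hx

/-- If a Minkowski sum is spanned by the points `q i + r i`, then its first summand is spanned by
the points `q i`. The decompositions need not be unique. -/
theorem eq_convexHull_range_of_add {E ι : Type*} [AddCommGroup E] [Module ℝ E]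
    [TopologicalSpace E] [IsTopologicalAddGroup E] [ContinuousSMul ℝ E] [LocallyConvexSpace ℝ E]
    [T2Space E] [Finite ι] [Nonempty ι] {Q R : Set E} (hQ : Convex ℝ Q) {q r : ι → E}
    (hq : ∀ i, q i ∈ Q) (hr : ∀ i, r i ∈ R)
    (h : Q + R = convexHull ℝ (Set.range fun i => q i + r i)) :
    Q = convexHull ℝ (Set.range q) := by
  refine Set.Subset.antisymm (fun x hx => ?_) (convexHull_min (Set.range_subset_iff.2 hq) hQ)
  by_contra hxq
  obtain ⟨l, u, hlt, hux⟩ := geometric_hahn_banach_closed_point (convex_convexHull ℝ (Set.range q))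
    ((Set.finite_range q).isClosed_convexHull ℝ) hxq
  -- At a point `q i + r i` that maximizes `l`, the part `q i` maximizes `l` over `Q`.
  obtain ⟨i, hi⟩ := Finite.exists_max fun i => l (q i + r i)
  have h1 : l (x + r i) ≤ l (q i + r i) :=
    le_of_mem_convexHull l.toLinearMap (Set.forall_mem_range.2 hi)
      (h ▸ Set.add_mem_add hx (hr i))
  have h2 := hlt _ (subset_convexHull ℝ _ (Set.mem_range_self i))
  rw [map_add, map_add] at h1
  linarith

theorem image_smul_add_convexHull {E : Type*} [AddCommGroup E] [Module ℝ E] (c : ℝ) (t : E)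
    (S : Set E) :
    (fun x => c • x + t) '' convexHull ℝ S = convexHull ℝ ((fun x => c • x + t) '' S) :=
  (c • AffineMap.id ℝ E + AffineMap.const ℝ E t).image_convexHull S

/-! ### Matchings and their characteristic vectors -/

section Matching

variable {V : Type*} {G : SimpleGraph V}

theorem isEdgeMatching_empty : IsEdgeMatching G ∅ := fun _ he => he.elim

theorem isEdgeMatching_singleton (e : G.edgeSet) : IsEdgeMatching G {e} := by
  rintro a rfl b rfl h
  exact (h rfl).elim

theorem IsEdgeMatching.mono {M N : Set G.edgeSet} (hN : IsEdgeMatching G N) (h : M ⊆ N) :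
    IsEdgeMatching G M :=
  fun e he f hf => hN e (h he) f (h hf)

theorem matchingPolytope_eq_convexHull_range (G : SimpleGraph V) :
    matchingPolytope G =
      convexHull ℝ (Set.range fun M : {M : Set G.edgeSet // IsEdgeMatching G M} =>
        (M : Set G.edgeSet).indicator (1 : G.edgeSet → ℝ)) := by
  refine congrArg _ (Set.ext fun x => ?_)
  exact ⟨fun ⟨M, hM, h⟩ => ⟨⟨M, hM⟩, h.symm⟩, fun ⟨M, h⟩ => ⟨M, M.2, h.symm⟩⟩

theorem indicator_mem_matchingPolytope {M : Set G.edgeSet} (hM : IsEdgeMatching G M) :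
    M.indicator 1 ∈ matchingPolytope G :=
  subset_convexHull ℝ _ ⟨M, hM, rfl⟩

/-- The polytope spanned by the matchings that use only edges in `A`. -/
def matchingPolytopeIn (G : SimpleGraph V) (A : Set G.edgeSet) : Set (G.edgeSet → ℝ) :=
  convexHull ℝ {x | ∃ M : Set G.edgeSet, (IsEdgeMatching G M ∧ M ⊆ A) ∧ x = M.indicator 1}

theorem isPolytope_convexHull_indicator [Finite V] (p : Set G.edgeSet → Prop) :
    IsPolytope
      (convexHull ℝ {x : G.edgeSet → ℝ | ∃ M : Set G.edgeSet, p M ∧ x = M.indicator 1}) := by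
  refine ⟨_, (Set.finite_range fun M : Set G.edgeSet => M.indicator (1 : G.edgeSet → ℝ)).subset ?_,
    rfl⟩
  rintro x ⟨M, -, rfl⟩
  exact ⟨M, rfl⟩

/-! ### Disconnected graphs -/

/-- If no edge in `A` meets an edge outside `A`, then the matching polytope splits accordingly. -/
theorem matchingPolytope_eq_add {A : Set G.edgeSet}
    (hA : ∀ e ∈ A, ∀ f ∉ A, ¬ ∃ v : V, v ∈ (e : Sym2 V) ∧ v ∈ (f : Sym2 V)) :
    matchingPolytope G = matchingPolytopeIn G A + matchingPolytopeIn G Aᶜ := by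
  rw [matchingPolytope, matchingPolytopeIn, matchingPolytopeIn, ← convexHull_add]
  congr 1
  ext x
  constructor
  · rintro ⟨M, hM, rfl⟩
    refine ⟨(M ∩ A).indicator 1,
      ⟨_, ⟨hM.mono Set.inter_subset_left, Set.inter_subset_right⟩, rfl⟩, (M ∩ Aᶜ).indicator 1,
      ⟨_, ⟨hM.mono Set.inter_subset_left, Set.inter_subset_right⟩, rfl⟩, ?_⟩
    change (M ∩ A).indicator 1 + (M ∩ Aᶜ).indicator 1 = M.indicator 1
    exact (Set.indicator_union_of_disjoint (disjoint_compl_right.mono Set.inter_subset_right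
      Set.inter_subset_right) (1 : G.edgeSet → ℝ)).symm.trans (by rw [Set.inter_union_compl])
  · rintro ⟨_, ⟨M, ⟨hM, hMA⟩, rfl⟩, _, ⟨N, ⟨hN, hNA⟩, rfl⟩, rfl⟩
    refine ⟨M ∪ N, ?_, ?_⟩
    · rintro e (he | he) f (hf | hf) hne
      · exact hM e he f hf hne
      · exact hA e (hMA he) f (hNA hf)
      · exact fun ⟨v, h1, h2⟩ => hA f (hMA hf) e (hNA he) ⟨v, h2, h1⟩
      · exact hN e he f hf hne
    · exact (Set.indicator_union_of_disjoint
        (disjoint_compl_right.mono hMA hNA) (1 : G.edgeSet → ℝ)).symm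

theorem not_isHomothetic_matchingPolytopeIn {A : Set G.edgeSet} {e : G.edgeSet} (he : e ∉ A) :
    ¬ IsHomothetic (matchingPolytopeIn G A) (matchingPolytope G) := by
  rintro ⟨c, t, hc, h⟩
  have hle : ∀ x ∈ matchingPolytopeIn G A, x e = 0 := by
    intro x hx
    refine convexHull_min (t := {x | LinearMap.proj (R := ℝ) (φ := fun _ : G.edgeSet => ℝ) e x = 0})
      ?_ (convex_hyperplane (LinearMap.isLinear _) 0) hx
    rintro _ ⟨M, ⟨-, hM⟩, rfl⟩
    simpa using fun h => he (hM h)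
  have h0 := hle _ (h ▸ Set.mem_image_of_mem _ (indicator_mem_matchingPolytope isEdgeMatching_empty))
  have h1 := hle _
    (h ▸ Set.mem_image_of_mem _ (indicator_mem_matchingPolytope (isEdgeMatching_singleton e)))
  simp at h0 h1
  linarith

theorem isMinkowskiDecomposable_matchingPolytope [Finite V] {A : Set G.edgeSet}
    (hA : ∀ e ∈ A, ∀ f ∉ A, ¬ ∃ v : V, v ∈ (e : Sym2 V) ∧ v ∈ (f : Sym2 V))
    (hne : A.Nonempty) (hne' : Aᶜ.Nonempty) :
    IsMinkowskiDecomposable (matchingPolytope G) := by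
  obtain ⟨e, he⟩ := hne
  obtain ⟨f, hf⟩ := hne'
  exact ⟨matchingPolytopeIn G A, matchingPolytopeIn G Aᶜ, isPolytope_convexHull_indicator _,
    isPolytope_convexHull_indicator _, matchingPolytope_eq_add hA,
    not_isHomothetic_matchingPolytopeIn hf, not_isHomothetic_matchingPolytopeIn (not_not.2 he)⟩

theorem SimpleGraph.Reachable.of_mem_edge {u v w : V} {e : Sym2 V} (he : e ∈ G.edgeSet)
    (hv : v ∈ e) (hw : w ∈ e) (h : G.Reachable u v) : G.Reachable u w := by
  by_cases hvw : v = w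
  · exact hvw ▸ h
  · rw [(Sym2.mem_and_mem_iff hvw).1 ⟨hv, hw⟩, SimpleGraph.mem_edgeSet] at he
    exact h.trans he.reachable

theorem connected_of_not_isMinkowskiDecomposable [Finite V] [Nonempty V]
    (hiso : ∀ v : V, ∃ w : V, G.Adj v w)
    (h : ¬ IsMinkowskiDecomposable (matchingPolytope G)) : G.Connected := by
  refine ⟨fun u v => ?_⟩
  by_contra huv
  -- Split along the set of edges in the component of `u`.
  refine h (isMinkowskiDecomposable_matchingPolytope
    (A := {e | ∃ w ∈ (e : Sym2 V), G.Reachable u w}) ?_ ?_ ?_)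
  · rintro e ⟨w, hw, huw⟩ f hf ⟨x, hxe, hxf⟩
    exact hf ⟨x, hxf, huw.of_mem_edge e.2 hw hxe⟩
  · obtain ⟨w, hw⟩ := hiso u
    exact ⟨⟨s(u, w), hw⟩, u, Sym2.mem_mk_left u w, .refl u⟩
  · obtain ⟨w, hw⟩ := hiso v
    refine ⟨⟨s(v, w), hw⟩, ?_⟩
    rintro ⟨x, hx, hux⟩
    exact huv (hux.of_mem_edge (e := s(v, w)) hw hx (Sym2.mem_mk_left v w))

/-! ### Connected graphs -/

/-- A function on the edges that agrees on any two edges with a common endpoint is constant. -/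
theorem SimpleGraph.Connected.edge_apply_eq {α : Type*} (hG : G.Connected) {l : G.edgeSet → α}
    (h : ∀ (v : V) (e f : G.edgeSet), v ∈ (e : Sym2 V) → v ∈ (f : Sym2 V) → l e = l f)
    (e f : G.edgeSet) : l e = l f := by
  have key : ∀ {u v : V}, G.Walk u v → ∀ e f : G.edgeSet,
      u ∈ (e : Sym2 V) → v ∈ (f : Sym2 V) → l e = l f := by
    intro u v p
    induction p with
    | nil => exact h _
    | @cons u w v huw p ih =>
      intro e f he hf
      exact (h u e ⟨s(u, w), huw⟩ he (Sym2.mem_mk_left u w)).trans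
        (ih ⟨s(u, w), huw⟩ f (Sym2.mem_mk_right u w) hf)
  obtain ⟨p⟩ := hG.preconnected (e : Sym2 V).out.1 (f : Sym2 V).out.1
  exact key p e f (Sym2.out_fst_mem _) (Sym2.out_fst_mem _)

theorem apply_eq_of_maximal_on_matchings {Q R : Set (G.edgeSet → ℝ)}
    (hP : matchingPolytope G = Q + R) (l : (G.edgeSet → ℝ) →ₗ[ℝ] ℝ) {c : ℝ}
    (hl : ∀ M : Set G.edgeSet, IsEdgeMatching G M → l (M.indicator 1) ≤ c)
    {q q' r r' : G.edgeSet → ℝ} (hq : q ∈ Q) (hq' : q' ∈ Q) (hr : r ∈ R) (hr' : r' ∈ R)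
    (h : l (q + r) = c) (h' : l (q' + r') = c) : l q = l q' := by
  refine apply_eq_of_add_maximal l (fun x hx => ?_) hq hq' hr hr' h h'
  rw [← hP] at hx
  refine le_of_mem_convexHull l ?_ hx
  rintro _ ⟨M, hM, rfl⟩
  exact hl M hM

/-- Up to the translation `q ∅`, the `Q`-parts of the vertices `1_M` are all obtained from `1_M` by
one and the same dilation. -/
theorem exists_matching_summand_eq (hG : G.Connected) {Q R : Set (G.edgeSet → ℝ)}
    (hP : matchingPolytope G = Q + R)
    {q r : {M : Set G.edgeSet // IsEdgeMatching G M} → G.edgeSet → ℝ}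
    (hq : ∀ M, q M ∈ Q) (hr : ∀ M, r M ∈ R)
    (hqr : ∀ M, q M + r M = (M : Set G.edgeSet).indicator 1) :
    ∃ c : ℝ, ∀ M, q M = c • (M : Set G.edgeSet).indicator 1 + q ⟨∅, isEdgeMatching_empty⟩ := by
  classical
  set q₀ := q ⟨∅, isEdgeMatching_empty⟩
  let q₁ (e : G.edgeSet) := q ⟨{e}, isEdgeMatching_singleton e⟩
  have key : ∀ (l : (G.edgeSet → ℝ) →ₗ[ℝ] ℝ) (c : ℝ)
      (_ : ∀ M : Set G.edgeSet, IsEdgeMatching G M → l (M.indicator 1) ≤ c)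
      (M N : {M : Set G.edgeSet // IsEdgeMatching G M}),
      l ((M : Set G.edgeSet).indicator 1) = c → l ((N : Set G.edgeSet).indicator 1) = c →
      l (q M) = l (q N) := fun l c hl M N hM hN =>
    apply_eq_of_maximal_on_matchings hP l hl (hq M) (hq N) (hr M) (hr N)
      (by rw [hqr, hM]) (by rw [hqr, hN])
  -- The functional `-x_e` is maximal at the matchings that avoid `e`.
  have hout : ∀ (M : {M : Set G.edgeSet // IsEdgeMatching G M}) (e : G.edgeSet),
      e ∉ (M : Set G.edgeSet) → q M e = q₀ e := by
    intro M e he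
    have := key (-LinearMap.proj e) 0 (fun N _ => by
      simp [Set.indicator_nonneg]) M ⟨∅, isEdgeMatching_empty⟩ (by simp [he]) (by simp)
    simpa using this
  -- The functional `x_e` is maximal at the matchings that contain `e`.
  have hin : ∀ (M : {M : Set G.edgeSet // IsEdgeMatching G M}) (e : G.edgeSet),
      e ∈ (M : Set G.edgeSet) → q M e = q₁ e e := by
    intro M e he
    exact key (LinearMap.proj e) 1 (fun N _ => by
      by_cases h : e ∈ N <;> simp [h]) M ⟨{e}, isEdgeMatching_singleton e⟩
      (by simp [he]) (by simp)
  -- For distinct edges `e`, `f` with a common endpoint, `x_e + x_f` is maximal at `{e}` and `{f}`.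
  have hadj : ∀ (v : V) (e f : G.edgeSet), v ∈ (e : Sym2 V) → v ∈ (f : Sym2 V) →
      q₁ e e - q₀ e = q₁ f f - q₀ f := by
    intro v e f he hf
    by_cases hef : e = f
    · rw [hef]
    have := key ((LinearMap.proj e : (G.edgeSet → ℝ) →ₗ[ℝ] ℝ) + LinearMap.proj f) 1 (fun N hN => by
      by_cases h : e ∈ N <;> by_cases h' : f ∈ N
      · exact (hN e h f h' hef ⟨v, he, hf⟩).elim
      all_goals simp [h, h']) ⟨{e}, isEdgeMatching_singleton e⟩ ⟨{f}, isEdgeMatching_singleton f⟩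
      (by simp [Ne.symm hef]) (by simp [hef])
    have h1 := hout ⟨{e}, isEdgeMatching_singleton e⟩ f (Ne.symm hef)
    have h2 := hout ⟨{f}, isEdgeMatching_singleton f⟩ e hef
    simp only [LinearMap.add_apply, LinearMap.proj_apply] at this
    rw [h1, h2] at this
    change q₁ e e + q₀ f = q₀ e + q₁ f f at this
    linarith
  have hconst := hG.edge_apply_eq hadj
  rcases isEmpty_or_nonempty G.edgeSet with hE | ⟨⟨e₀⟩⟩
  · exact ⟨0, fun M => Subsingleton.elim _ _⟩
  refine ⟨q₁ e₀ e₀ - q₀ e₀, fun M => ?_⟩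
  ext e
  by_cases he : e ∈ (M : Set G.edgeSet)
  · rw [hin M e he, ← hconst e e₀]
    simp [he]
  · rw [hout M e he]
    simp [he]

theorem not_isMinkowskiDecomposable_of_connected [Finite V] (hG : G.Connected) :
    ¬ IsMinkowskiDecomposable (matchingPolytope G) := by
  rintro ⟨Q, R, ⟨S, -, hS⟩, ⟨T, -, hT⟩, hP, hnQ, hnR⟩
  have hQ : Convex ℝ Q := hS ▸ convex_convexHull ℝ S
  have hR : Convex ℝ R := hT ▸ convex_convexHull ℝ T
  have hdec : ∀ M : {M : Set G.edgeSet // IsEdgeMatching G M}, ∃ q ∈ Q, ∃ r ∈ R,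
      q + r = (M : Set G.edgeSet).indicator 1 := fun M =>
    Set.mem_add.1 (hP ▸ indicator_mem_matchingPolytope M.2)
  choose q hq r hr hqr using hdec
  have : Nonempty {M : Set G.edgeSet // IsEdgeMatching G M} := ⟨⟨∅, isEdgeMatching_empty⟩⟩
  obtain ⟨c, hc⟩ := exists_matching_summand_eq hG hP hq hr hqr
  have hc' : ∀ M, r M = (1 - c) • (M : Set G.edgeSet).indicator 1 +
      r ⟨∅, isEdgeMatching_empty⟩ := by
    intro M
    have h0 := hqr ⟨∅, isEdgeMatching_empty⟩
    have h1 := hqr M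
    rw [Set.indicator_empty', add_eq_zero_iff_eq_neg] at h0
    rw [hc M, h0] at h1
    rw [sub_smul, one_smul]
    linear_combination (exp := 1) h1
  have hQ' : Q = convexHull ℝ (Set.range q) := eq_convexHull_range_of_add hQ hq hr (by
    rw [← hP, matchingPolytope_eq_convexHull_range]; simp only [hqr])
  have hR' : R = convexHull ℝ (Set.range r) := eq_convexHull_range_of_add hR hr hq (by
    rw [add_comm, ← hP, matchingPolytope_eq_convexHull_range]; simp only [add_comm (r _), hqr])
  have himage : ∀ (p : {M : Set G.edgeSet // IsEdgeMatching G M} → G.edgeSet → ℝ) (a : ℝ)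
      (t : G.edgeSet → ℝ), (∀ M, p M = a • (M : Set G.edgeSet).indicator 1 + t) →
      convexHull ℝ (Set.range p) = (fun x => a • x + t) '' matchingPolytope G := by
    intro p a t h
    rw [matchingPolytope_eq_convexHull_range, image_smul_add_convexHull, ← Set.range_comp]
    congr 2
    exact funext h
  rcases lt_or_ge 0 c with h | h
  · exact hnQ ⟨c, _, h, hQ'.trans (himage q c _ hc)⟩
  · exact hnR ⟨1 - c, _, by linarith, hR'.trans (himage r (1 - c) _ hc')⟩

end Matching

theorem corollary4p6 {V : Type*} [Finite V] (G : SimpleGraph V)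
    (hiso : ∀ v : V, ∃ w : V, G.Adj v w) (hedge : G.edgeSet.Nonempty) :
    IsIndecomposablePolytope (matchingPolytope G) ↔ G.Connected := by
  obtain ⟨e, -⟩ := hedge
  have : Nonempty V := ⟨e.out.1⟩
  exact ⟨fun h => connected_of_not_isMinkowskiDecomposable hiso h.2,
    fun h => ⟨isPolytope_convexHull_indicator _, not_isMinkowskiDecomposable_of_connected h⟩⟩
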